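/- An \emph{mm-space} $X=(X,d_X,\mu_X)$ is a complete separable metric space with a Borel probability measure. As usual, every mm-space is replaced by the support of its measure, so that $X=\operatorname{supp}\mu_X$. Let $\mathcal{X}$ be the set of mm-isomorphism classes, where $X$ and $Y$ are mm-isomorphic if there is a bijective isometry $f:X\to Y$ with $f_*\mu_X=\mu_Y$. Write $Y\prec X$ if there is a $1$-Lipschitz map $f:X\to Y$ with $f_*\mu_X=\mu_Y$. The box distance is \[\square(X,Y)=\inf_{\pi,S}\max\{\operatorname{dis}(S),\,1-\pi(S)\},\] over all couplings $\pi$ of $\mu_X$ and $\mu_Y$ and all Borel sets $S\subset X\times Y$, where $\operatorname{dis}(S)=\sup\{|d_X(x,x')-d_Y(y,y')| : (x,y),(x',y')\in S\}$ (and $\operatorname{dis}(\emptyset)=0$). A \emph{pyramid} is a nonempty subset $\mathcal{P}\subset\mathcal{X}$ that is closed in the box topology, contains every $X\prec Y$ whenever $Y\in\mathcal{P}$, and is directed: for $X,Y\in\mathcal{P}$ there is $Z\in\mathcal{P}$ with $X\prec Z$ and $Y\prec Z$. For an mm-space $X$ put $\mathcal{P}_X=\{Y\in\mathcal{X}: Y\prec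 X\}$. For $0<\kappa<1$ let \[\operatorname{ObsDiam}(X;-\kappa)=\sup_{f}\ \inf\{\operatorname{diam}A : A\subset\mathbb{R}\text{ Borel},\ f_*\mu_X(A)\ge 1-\kappa\},\] the supremum being over all $1$-Lipschitz $f:X\to\mathbb{R}$, and let $\operatorname{ObsDiam}(\mathcal{P};-\kappa)=\sup_{X\in\mathcal{P}}\operatorname{ObsDiam}(X;-\kappa)$. The pyramid $\mathcal{P}$ \emph{has finite observable diameter} if $\operatorname{ObsDiam}(\mathcal{P};-\kappa)<\infty$ for every $0<\kappa<1$. For $r>0$ and $0<\kappa<1$ let \[\operatorname{Cov}(X;r,\kappa)=\min\{\#\mathcal{N} : \mathcal{N}\subset X,\ \mu_X(B_r(\mathcal{N}))\ge 1-\kappa\},\qquad \operatorname{Cov}(\mathcal{P};r,\kappa)=\sup_{X\in\mathcal{P}}\operatorname{Cov}(X;r,\kappa),\] where $B_r(\mathcal{N})=\{x\in X: d_X(x,\mathcal{N})\le r\}$ (so $B_r(\emptyset)=\emptyset$). \textbf{Lemma.} Let $\mathcal{P}$ be a pyramid of finite observable diameter. Then the following are equivalent: \begin{enumerate} \item[(i)]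 $\operatorname{Cov}(\mathcal{P};r,\kappa)<+\infty$ for every $r>0$ and every $0<\kappa<1$; \item[(ii)] there exists an mm-space $X$ such that $\mathcal{P}=\mathcal{P}_X$. \end{enumerate} -/

import Mathlib

open MeasureTheory
open scoped ENNReal

universe u

/-- An mm-space: a complete separable metric space with a Borel probability measure.
Following the usual convention, the space is identified with the support of its measure,
that is, the measure is positive on nonempty open sets. -/
structure MMSpace : Type (u + 1) where
  carrier : Type u
  [metric : MetricSpace carrier]
  [complete : CompleteSpace carrier]
  [separable : TopologicalSpace.SeparableSpace carrier]
  [measurable : MeasurableSpace carrier]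
  [borel : BorelSpace carrier]
  measure : Measure carrier
  [probability : IsProbabilityMeasure measure]
  [fullSupport : measure.IsOpenPosMeasure]

namespace MMSpace

instance : CoeSort MMSpace.{u} (Type u) := ⟨carrier⟩

attribute [instance] metric complete separable measurable borel probability fullSupport

/-- mm-isomorphism: a bijective isometry that pushes one measure forward to the other. -/
def Iso (X Y : MMSpace.{u}) : Prop :=
  ∃ f : X ≃ᵢ Y, X.measure.map f = Y.measure

theorem Iso.refl (X : MMSpace.{u}) : Iso X X :=
  ⟨IsometryEquiv.refl X, Measure.map_id⟩

theorem Iso.symm {X Y : MMSpace.{u}} (h : Iso X Y) : Iso Y X := by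
  obtain ⟨f, hf⟩ := h
  refine ⟨f.symm, ?_⟩
  rw [← hf, Measure.map_map f.symm.continuous.measurable f.continuous.measurable,
    show (f.symm : Y → X) ∘ f = id from funext f.symm_apply_apply, Measure.map_id]

theorem Iso.trans {X Y Z : MMSpace.{u}} (h : Iso X Y) (h' : Iso Y Z) : Iso X Z := by
  obtain ⟨f, hf⟩ := h
  obtain ⟨g, hg⟩ := h'
  refine ⟨f.trans g, ?_⟩
  rw [← hg, ← hf, Measure.map_map g.continuous.measurable f.continuous.measurable]
  rfl

instance isoSetoid : Setoid MMSpace.{u} where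
  r := Iso
  iseqv := ⟨Iso.refl, Iso.symm, Iso.trans⟩

/-- The Lipschitz order: `Dominates X Y` is `Y ≺ X`, that is, some 1-Lipschitz map `X → Y`
pushes the measure of `X` forward to the measure of `Y`. -/
def Dominates (X Y : MMSpace.{u}) : Prop :=
  ∃ f : X → Y, LipschitzWith 1 f ∧ X.measure.map f = Y.measure

/-- The distortion of a subset of `X × Y`; it is `0` for the empty set. -/
noncomputable def distortion {X Y : Type u} [MetricSpace X] [MetricSpace Y]
    (S : Set (X × Y)) : ℝ≥0∞ :=
  ⨆ p ∈ S, ⨆ q ∈ S, ENNReal.ofReal |dist p.1 q.1 - dist p.2 q.2|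

/-- `π` is a coupling of the measures of `X` and `Y`. -/
def IsCoupling (X Y : MMSpace.{u}) (π : Measure (X × Y)) : Prop :=
  π.map Prod.fst = X.measure ∧ π.map Prod.snd = Y.measure

/-- The box distance: the infimum of `max (dis S) (1 - π S)` over couplings `π` and Borel
sets `S ⊆ X × Y`. -/
noncomputable def boxDist (X Y : MMSpace.{u}) : ℝ≥0∞ :=
  ⨅ (π : Measure (X × Y)) (_ : IsCoupling X Y π) (S : Set (X × Y)) (_ : MeasurableSet S),
    max (distortion S) (1 - π S)

/-- The `(r, κ)`-covering number: the least cardinality of a set `N ⊆ X` whose closed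
`r`-neighbourhood `B_r(N)` has measure at least `1 - κ`. -/
noncomputable def cov (X : MMSpace.{u}) (r κ : ℝ) : ℕ∞ :=
  ⨅ (N : Set X) (_ : ENNReal.ofReal (1 - κ) ≤ X.measure (Metric.cthickening r N)), N.encard

/-- The partial diameter `diam(ν; α)`: the infimum of the diameters of the Borel sets of
`ν`-measure at least `α`. -/
noncomputable def partialDiam (ν : Measure ℝ) (α : ℝ) : ℝ≥0∞ :=
  ⨅ (A : Set ℝ) (_ : MeasurableSet A) (_ : ENNReal.ofReal α ≤ ν A), Metric.ediam A

/-- The `κ`-observable diameter `ObsDiam(X; -κ)`. -/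
noncomputable def obsDiam (X : MMSpace.{u}) (κ : ℝ) : ℝ≥0∞ :=
  ⨆ (f : X → ℝ) (_ : LipschitzWith 1 f), partialDiam (X.measure.map f) (1 - κ)

end MMSpace

/-- The set of all mm-isomorphism classes of mm-spaces. -/
def MMClass : Type (u + 1) := Quotient MMSpace.isoSetoid.{u}

namespace MMClass

/-- The mm-isomorphism class of an mm-space. -/
def mk (X : MMSpace.{u}) : MMClass.{u} := Quotient.mk _ X

/-- The box topology: `U` is open when it contains, with each of its points, a box-distance
ball of positive radius around this point. -/
instance boxTopology : TopologicalSpace MMClass.{u} where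
  IsOpen U := ∀ X : MMSpace.{u}, mk X ∈ U →
    ∃ ε : ℝ≥0∞, 0 < ε ∧ ∀ Y : MMSpace.{u}, MMSpace.boxDist X Y < ε → mk Y ∈ U
  isOpen_univ := fun _ _ => ⟨1, one_pos, fun _ _ => Set.mem_univ _⟩
  isOpen_inter := by
    intro U V hU hV X hX
    obtain ⟨ε, hε, h⟩ := hU X hX.1
    obtain ⟨δ, hδ, h'⟩ := hV X hX.2
    exact ⟨min ε δ, lt_min hε hδ, fun Y hY =>
      ⟨h Y (hY.trans_le (min_le_left _ _)), h' Y (hY.trans_le (min_le_right _ _))⟩⟩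
  isOpen_sUnion := by
    intro S hS X hX
    obtain ⟨U, hU, hXU⟩ := hX
    obtain ⟨ε, hε, h⟩ := hS U hU X hXU
    exact ⟨ε, hε, fun Y hY => ⟨U, hU, h Y hY⟩⟩

/-- A pyramid: a nonempty, box-closed, downward closed and directed set of mm-isomorphism
classes with respect to the Lipschitz order. -/
structure IsPyramid (P : Set MMClass.{u}) : Prop where
  nonempty : P.Nonempty
  closed : IsClosed P
  downward : ∀ X Y : MMSpace.{u}, mk Y ∈ P → Y.Dominates X → mk X ∈ P
  directed : ∀ X Y : MMSpace.{u}, mk X ∈ P → mk Y ∈ P →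
    ∃ Z : MMSpace.{u}, mk Z ∈ P ∧ Z.Dominates X ∧ Z.Dominates Y

/-- The pyramid `P_X` associated with `X`: the classes of all mm-spaces `Y ≺ X`. -/
def associatedPyramid (X : MMSpace.{u}) : Set MMClass.{u} :=
  {y | ∃ Y : MMSpace.{u}, mk Y = y ∧ X.Dominates Y}

/-- The `(r, κ)`-covering number of a set of mm-isomorphism classes. -/
noncomputable def cov (P : Set MMClass.{u}) (r κ : ℝ) : ℕ∞ :=
  ⨆ (X : MMSpace.{u}) (_ : mk X ∈ P), X.cov r κ

/-- The `κ`-observable diameter of a set of mm-isomorphism classes. -/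
noncomputable def obsDiam (P : Set MMClass.{u}) (κ : ℝ) : ℝ≥0∞ :=
  ⨆ (X : MMSpace.{u}) (_ : mk X ∈ P), X.obsDiam κ

/-- The observable diameter of `P` is finite. -/
def FiniteObsDiam (P : Set MMClass.{u}) : Prop :=
  ∀ κ : ℝ, 0 < κ → κ < 1 → obsDiam P κ < ⊤

end MMClass

/-!
If `P = P_X`, then every element of `P` is a 1-Lipschitz image of `X`, and the image of a net of `X`
is a net of at most the same cardinality; hence `Cov(P; r, κ) ≤ Cov(X; r, κ)`, which is finite
because `X` is separable.

Conversely, it suffices to find an element `X` of `P` that is maximal for the Lipschitz order: by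
directedness every `Y ∈ P` is dominated by some `Z ∈ P` that also dominates `X`, and maximality
forces `Z ≅ X`. Maximality is tested by the bounded functional `MMSpace.spread`, the mean of
`arctan d(x, x')`: it is monotone, and a domination that preserves it is an mm-isomorphism
(`MMSpace.Dominates.iso_of_spread_le`). To see that the spread attains its supremum on `P`
(`MMClass.exists_forall_spread_le_of_isPyramid`), take an increasing chain `Y 0 ≺ Y 1 ≺ …` in `P`
whose spreads tend to the supremum, and bound it above by an element of `P`.

This upper bound is the inverse limit of the chain (`MMSpace.CompatibleSeq`), with the supremum of
the coordinate distances as metric. A projective limit of the measures exists by the theorem of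
Ionescu-Tulcea (`exists_measure_pi_of_measurePreserving`). The metric could be infinite and the space
nonseparable; the bound on the observable diameters excludes the first
(`MMSpace.CompatibleSeq.ae_edist_lt_top`) and the bound on the covering numbers excludes the second
(`MMSpace.CompatibleSeq.exists_finset_cover`), up to null sets. Restricting to the support of the
measure gives an mm-space that dominates the whole chain (`exists_mmSpace_isometry`). On a finite
union of small balls of measure close to one, the distance of this space is uniformly close to the
one of `Y n` for some `n`, so the chain comes arbitrarily close to it in the box distance
(`MMSpace.exists_dominates_forall_boxDist_le`), and it belongs to `P` because `P` is closed.
-/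

/-! ### Projective limits of probability measures -/

section ProjectiveLimit

open ProbabilityTheory

theorem map_prodMap_compProd_comap {α β γ : Type*} [MeasurableSpace α] [MeasurableSpace β]
    [MeasurableSpace γ] (ν : Measure α) [SFinite ν] (η : Kernel β γ) [IsSFiniteKernel η]
    {g : α → β} (hg : Measurable g) :
    (ν.compProd (η.comap g hg)).map (Prod.map g id) = (ν.map g).compProd η := by
  ext s hs
  rw [Measure.map_apply (hg.prodMap measurable_id) hs, Measure.compProd_apply hs,
    Measure.compProd_apply (hg.prodMap measurable_id hs),
    lintegral_map (Kernel.measurable_kernel_prodMk_left hs) hg]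
  rfl

/-- A sequence of standard Borel probability spaces linked by measure-preserving maps
`f n : Y (n + 1) → Y n` has a projective limit: there is a probability measure on the product
whose marginals are the given measures and which is carried by the compatible sequences.
It is the law of the Markov chain that starts with `m 0` and moves from `Y n` to `Y (n + 1)`
by the conditional distribution on the fibres of `f n`. -/
theorem exists_measure_pi_of_measurePreserving {Y : ℕ → Type u} [∀ n, MeasurableSpace (Y n)]
    [∀ n, StandardBorelSpace (Y n)] (m : ∀ n, Measure (Y n)) [∀ n, IsProbabilityMeasure (m n)]
    (f : ∀ n, Y (n + 1) → Y n) (hf : ∀ n, MeasurePreserving (f n) (m (n + 1)) (m n)) :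
    ∃ μ : Measure (∀ n, Y n), IsProbabilityMeasure μ ∧
      (∀ n, μ.map (fun x => x n) = m n) ∧ ∀ᵐ x ∂μ, ∀ n, f n (x (n + 1)) = x n := by
  have hne (n : ℕ) : Nonempty (Y n) := nonempty_of_isProbabilityMeasure (m n)
  have hev (n : ℕ) : Measurable fun x : ∀ i : Finset.Iic n, Y i => x ⟨n, by simp⟩ :=
    measurable_pi_apply _
  let κ (n : ℕ) : Kernel (∀ i : Finset.Iic n, Y i) (Y (n + 1)) :=
    (condDistrib id (f n) (m (n + 1))).comap (fun x => x ⟨n, by simp⟩) (hev n)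
  let μ : Measure (∀ n, Y n) := Kernel.trajMeasure (m 0) κ
  have hμ : IsProbabilityMeasure μ := by infer_instance
  have hg (n : ℕ) : Measurable fun y => (f n y, y) := (hf n).measurable.prodMk measurable_id
  have hstep (n : ℕ) (hn : μ.map (fun x => x n) = m n) :
      μ.map (fun x => (x n, x (n + 1))) = (m (n + 1)).map fun y => (f n y, y) := by
    have h := congrArg (Measure.map (Prod.map (fun x : ∀ i : Finset.Iic n, Y i => x ⟨n, by simp⟩)
      (id : Y (n + 1) → Y (n + 1))))
      (Kernel.map_frestrictLe_trajMeasure_compProd_eq_map_trajMeasure (μ₀ := m 0) (κ := κ) (a := n))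
    have hr : Measurable (Preorder.frestrictLe (π := Y) n) := Preorder.measurable_frestrictLe n
    have : IsProbabilityMeasure (μ.map (Preorder.frestrictLe (π := Y) n)) :=
      Measure.isProbabilityMeasure_map hr.aemeasurable
    rw [map_prodMap_compProd_comap, Measure.map_map (hev n) hr,
      Measure.map_map ((hev n).prodMap measurable_id) (by fun_prop)] at h
    change (μ.map (fun x => x n)).compProd _ = μ.map (fun x => (x n, x (n + 1))) at h
    rw [← h, hn, ← (hf n).map_eq, compProd_map_condDistrib aemeasurable_id]
    rfl
  have hzero : μ.map (fun x => x 0) = m 0 := by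
    have hr : Measurable (Preorder.frestrictLe (π := Y) 0) := Preorder.measurable_frestrictLe 0
    let e : Y 0 → ∀ i : Finset.Iic 0, Y i :=
      (MeasurableEquiv.piUnique fun i : Finset.Iic 0 => Y i).symm
    have he : Measurable e :=
      (MeasurableEquiv.piUnique fun i : Finset.Iic 0 => Y i).symm.measurable
    have h : μ.map (Preorder.frestrictLe 0) = (m 0).map e := by
      change (Measure.bind ((m 0).map e) (Kernel.traj κ 0)).map _ = _
      rw [Measure.map_comp _ _ hr, Kernel.traj_map_frestrictLe, Kernel.partialTraj_self,
        Measure.id_comp]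
    have h' := congrArg (Measure.map fun x : ∀ i : Finset.Iic 0, Y i => x ⟨0, by simp⟩) h
    rw [Measure.map_map (hev 0) hr, Measure.map_map (hev 0) he] at h'
    exact h'.trans Measure.map_id
  have hmarg (n : ℕ) : μ.map (fun x => x n) = m n := by
    induction n with
    | zero => exact hzero
    | succ n ih =>
      have h := congrArg (Measure.map Prod.snd) (hstep n ih)
      rw [Measure.map_map measurable_snd (by fun_prop),
        Measure.map_map measurable_snd (hg n)] at h
      exact h.trans Measure.map_id
  refine ⟨μ, hμ, hmarg, ae_all_iff.2 fun n => ?_⟩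
  have hS : MeasurableSet {p : Y n × Y (n + 1) | f n p.2 = p.1} :=
    measurableSet_eq_fun ((hf n).measurable.comp measurable_snd) measurable_fst
  have hp : Measurable fun x : ∀ n, Y n => (x n, x (n + 1)) := by fun_prop
  have : ∀ᵐ p ∂(μ.map fun x => (x n, x (n + 1))), f n p.2 = p.1 := by
    rw [hstep n (hmarg n),
      ae_map_iff (hg n).aemeasurable hS]
    exact ae_of_all _ fun y => rfl
  exact (ae_map_iff hp.aemeasurable hS).1 this

end ProjectiveLimit

/-! ### Sets that are visited infinitely often -/

/-- If infinitely many of the sets `B n` have measure at least `δ > 0`, then some point lies in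
infinitely many of these. -/
theorem exists_frequently_mem_of_frequently_le_measure {α : Type*} [MeasurableSpace α]
    {μ : Measure α} [IsFiniteMeasure μ] {B : ℕ → Set α} (hB : ∀ n, MeasurableSet (B n))
    {δ : ℝ≥0∞} (hδ : δ ≠ 0) {p : ℕ → Prop} (hp : ∃ᶠ n in Filter.atTop, p n)
    (hpB : ∀ n, p n → δ ≤ μ (B n)) : ∃ x, ∃ᶠ n in Filter.atTop, p n ∧ x ∈ B n := by
  let C (n : ℕ) : Set α := ⋃ k, ⋃ (_ : n ≤ k ∧ p k), B k
  have hC : Antitone C := fun a b hab =>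
    Set.iUnion_mono fun k => Set.iUnion_mono' fun h => ⟨⟨hab.trans h.1, h.2⟩, le_rfl⟩
  have hlim := tendsto_measure_iInter_atTop (μ := μ)
    (fun n => (MeasurableSet.iUnion fun k => MeasurableSet.iUnion fun _ =>
      hB k : MeasurableSet (C n)).nullMeasurableSet) hC ⟨0, measure_ne_top μ _⟩
  have hle : δ ≤ μ (⋂ n, C n) := ge_of_tendsto' hlim fun n => by
    obtain ⟨k, hk, hpk⟩ := Filter.frequently_atTop.1 hp n
    exact (hpB k hpk).trans (measure_mono (Set.subset_iUnion₂ (s := fun k _ => B k) k ⟨hk, hpk⟩))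
  obtain ⟨x, hx⟩ := nonempty_of_measure_ne_zero (ne_of_gt (hδ.bot_lt.trans_le hle))
  refine ⟨x, Filter.frequently_atTop.2 fun n => ?_⟩
  obtain ⟨k, hk, hxk⟩ := Set.mem_iUnion₂.1 (Set.mem_iInter.1 hx n)
  exact ⟨k, hk.1, hk.2, hxk⟩

namespace MMSpace

/-! ### Covering numbers and the Lipschitz order -/

theorem Dominates.trans {X Y Z : MMSpace.{u}} (h : X.Dominates Y) (h' : Y.Dominates Z) :
    X.Dominates Z := by
  obtain ⟨f, hf, hfm⟩ := h
  obtain ⟨g, hg, hgm⟩ := h'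
  refine ⟨g ∘ f, by simpa using hg.comp hf, ?_⟩
  rw [← hgm, ← hfm, Measure.map_map hg.continuous.measurable hf.continuous.measurable]

theorem Iso.dominates {X Y : MMSpace.{u}} (h : Iso X Y) : X.Dominates Y :=
  let ⟨f, hf⟩ := h
  ⟨f, f.isometry.lipschitz, hf⟩

theorem Dominates.cov_le {X Y : MMSpace.{u}} (h : X.Dominates Y) (r κ : ℝ) :
    Y.cov r κ ≤ X.cov r κ := by
  obtain ⟨f, hf, hfm⟩ := h
  refine le_iInf₂ fun N hN => (iInf₂_le (f '' N) (hN.trans ?_)).trans (Set.encard_image_le f N)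
  rw [← hfm, Measure.map_apply hf.continuous.measurable Metric.isClosed_cthickening.measurableSet]
  refine measure_mono fun x hx => ?_
  refine le_trans (le_of_forall_gt fun b hb => ?_) (Metric.mem_cthickening_iff.1 hx)
  obtain ⟨y, hy, hxy⟩ := Metric.infEDist_lt_iff.1 hb
  exact ((Metric.infEDist_le_edist_of_mem (Set.mem_image_of_mem f hy)).trans
    (by simpa using hf x y)).trans_lt hxy

theorem cov_lt_top (X : MMSpace.{u}) {r κ : ℝ} (hr : 0 < r) (hκ : 0 < κ) : X.cov r κ < ⊤ := by
  have hne : Nonempty X := nonempty_of_isProbabilityMeasure X.measure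
  let s := TopologicalSpace.denseSeq X
  let A (n : ℕ) : Set X := Metric.cthickening r (s '' Set.Iic n)
  have hA : Monotone A := fun a b hab =>
    Metric.cthickening_subset_of_subset r (Set.image_mono (Set.Iic_subset_Iic.2 hab))
  have hU : ⋃ n, A n = Set.univ := Set.eq_univ_of_forall fun x => by
    obtain ⟨n, hn⟩ := (TopologicalSpace.denseRange_denseSeq X).exists_dist_lt x hr
    exact Set.mem_iUnion.2
      ⟨n, Metric.mem_cthickening_of_dist_le x (s n) r _ ⟨n, by simp, rfl⟩ hn.le⟩
  have hlim := tendsto_measure_iUnion_atTop (μ := X.measure) hA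
  rw [hU, measure_univ] at hlim
  have h1 : ENNReal.ofReal (1 - κ) < 1 := by
    rw [← ENNReal.ofReal_one]; exact (ENNReal.ofReal_lt_ofReal_iff one_pos).2 (by linarith)
  obtain ⟨n, hn⟩ := (hlim.eventually (lt_mem_nhds h1)).exists
  refine (iInf₂_le (s '' Set.Iic n) hn.le).trans_lt ?_
  exact ((Set.finite_Iic n).image s).encard_lt_top

/-! ### A strictly monotone functional -/

/-- The mean of `arctan d(x, x')` over independent `x, x'`. It is bounded, monotone for the
Lipschitz order, and strictly so up to mm-isomorphism. -/
noncomputable def spread (X : MMSpace.{u}) : ℝ≥0∞ :=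
  ∫⁻ p, ENNReal.ofReal (Real.arctan (dist p.1 p.2)) ∂(X.measure.prod X.measure)

theorem measurable_arctan_dist (X : MMSpace.{u}) :
    Measurable fun p : X × X => ENNReal.ofReal (Real.arctan (dist p.1 p.2)) :=
  (ENNReal.continuous_ofReal.comp
    (Real.continuous_arctan.comp continuous_dist)).measurable

theorem spread_ne_top (X : MMSpace.{u}) : X.spread ≠ ⊤ := by
  refine ne_top_of_le_ne_top (b := ENNReal.ofReal (Real.pi / 2)) ENNReal.ofReal_ne_top ?_
  refine (lintegral_mono fun p =>
    ENNReal.ofReal_le_ofReal (Real.arctan_lt_pi_div_two _).le).trans ?_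
  simp

theorem spread_eq_of_map_eq {X Z : MMSpace.{u}} {f : Z → X} (hf : LipschitzWith 1 f)
    (hm : Z.measure.map f = X.measure) :
    X.spread = ∫⁻ p, ENNReal.ofReal (Real.arctan (dist (f p.1) (f p.2)))
      ∂(Z.measure.prod Z.measure) := by
  have hfm := hf.continuous.measurable
  rw [spread, ← hm, Measure.map_prod_map _ _ hfm hfm,
    lintegral_map X.measurable_arctan_dist (hfm.prodMap hfm)]
  rfl

theorem Dominates.spread_le {X Z : MMSpace.{u}} (h : Z.Dominates X) : X.spread ≤ Z.spread := by
  obtain ⟨f, hf, hm⟩ := h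
  rw [spread_eq_of_map_eq hf hm]
  refine lintegral_mono fun p => ENNReal.ofReal_le_ofReal (Real.arctan_strictMono.monotone ?_)
  simpa using hf.dist_le_mul p.1 p.2

/-- A domination that does not increase the spread is an mm-isomorphism: the 1-Lipschitz map
preserves almost all distances, hence all of them by continuity and full support, and its image
is complete and of full measure, hence everything. -/
theorem Dominates.iso_of_spread_le {X Z : MMSpace.{u}} (h : Z.Dominates X)
    (hle : Z.spread ≤ X.spread) : Iso Z X := by
  obtain ⟨f, hf, hm⟩ := h
  have hfm := hf.continuous.measurable
  have hd (p : Z × Z) : dist (f p.1) (f p.2) ≤ dist p.1 p.2 := by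
    simpa using hf.dist_le_mul p.1 p.2
  have hfin : ∫⁻ p, ENNReal.ofReal (Real.arctan (dist (f p.1) (f p.2)))
      ∂(Z.measure.prod Z.measure) ≠ ⊤ := spread_eq_of_map_eq hf hm ▸ X.spread_ne_top
  have hae := ae_eq_of_ae_le_of_lintegral_le
    (ae_of_all _ fun p => ENNReal.ofReal_le_ofReal (Real.arctan_strictMono.monotone (hd p)))
    hfin Z.measurable_arctan_dist.aemeasurable (by rwa [← spread_eq_of_map_eq hf hm])
  have hae' : (fun p : Z × Z => dist (f p.1) (f p.2)) =ᵐ[Z.measure.prod Z.measure]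
      fun p => dist p.1 p.2 := by
    filter_upwards [hae] with p hp
    have h0 (t : ℝ) (ht : 0 ≤ t) : 0 ≤ Real.arctan t := Real.arctan_nonneg.2 ht
    rw [ENNReal.ofReal_eq_ofReal_iff (h0 _ dist_nonneg) (h0 _ dist_nonneg)] at hp
    exact Real.arctan_injective hp
  have heq := Continuous.ae_eq_iff_eq (Z.measure.prod Z.measure)
    (f := fun p : Z × Z => dist (f p.1) (f p.2)) (g := fun p => dist p.1 p.2)
    ((hf.continuous.comp continuous_fst).dist (hf.continuous.comp continuous_snd))
    continuous_dist |>.1 hae'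
  have hiso : Isometry f := Isometry.of_dist_eq fun x y => congrFun heq (x, y)
  have hcl : IsClosed (Set.range f) := hiso.isClosedEmbedding.isClosed_range
  have hdense : Dense (Set.range f) := by
    refine Measure.dense_of_ae (μ := X.measure) (p := fun y => y ∈ Set.range f) ?_
    rw [← hm]
    exact (ae_map_iff hfm.aemeasurable hcl.measurableSet).2 (ae_of_all _ fun x => ⟨x, rfl⟩)
  have hsurj : Function.Surjective f := by
    rw [← Set.range_eq_univ, ← hcl.closure_eq, hdense.closure_eq]
  exact ⟨⟨Equiv.ofBijective f ⟨hiso.injective, hsurj⟩, hiso⟩, hm⟩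

end MMSpace

/-! ### mm-spaces from measurable extended metrics -/

section Realization

variable {E : Type u} [EMetricSpace E] [MeasurableSpace E]

/-- If only the distance functions are known to be measurable, closed separable sets still are: such
a set is the zero set of the distance to a countable set. -/
theorem measurableSet_of_isClosed_of_isSeparable (hdist : ∀ x : E, Measurable (edist x))
    {C : Set E} (hC : IsClosed C) (hs : TopologicalSpace.IsSeparable C) : MeasurableSet C := by
  obtain ⟨T, hTC, hT, hCT⟩ := hs.exists_countable_dense_subset
  have hCeq : C = {y | ⨅ x ∈ T, edist x y = 0} := by
    ext y
    rw [Set.Subset.antisymm hCT (closure_minimal hTC hC), Metric.mem_closure_iff_infEDist_zero]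
    simp only [Metric.infEDist, Set.mem_ofPred_eq, edist_comm y]
  rw [hCeq]
  exact measurableSet_eq_fun (Measurable.biInf T hT fun x _ => hdist x) measurable_const

/-- A probability measure on a complete extended metric space is carried by an mm-space as soon as
almost all of the space is at finite distance from one point and, up to arbitrarily small measure,
is covered by finitely many balls of a given radius. The `σ`-algebra may be smaller than the Borel
`σ`-algebra, but makes the distance functions measurable. The mm-space is the set of the points all
of whose neighbourhoods have positive measure. -/
theorem exists_mmSpace_isometry [CompleteSpace E] (μ : Measure E) [IsProbabilityMeasure μ]
    (hdist : ∀ x : E, Measurable (edist x)) (hborel : ‹MeasurableSpace E› ≤ borel E) {o : E}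
    (ho : ∀ᵐ x ∂μ, edist o x < ⊤)
    (hcov : ∀ ε κ : ℝ≥0∞, 0 < ε → 0 < κ → ∃ F : Finset E, μ {y | ∀ x ∈ F, ε < edist x y} ≤ κ) :
    ∃ (X : MMSpace.{u}) (ι : X → E), Isometry ι ∧ Measurable ι ∧ X.measure.map ι = μ := by
  -- Almost every point is a limit of points of a countable set `D`.
  have hcov' (k j : ℕ) : ∃ F : Finset E,
      μ {y | ∀ x ∈ F, (k + 1 : ℝ≥0∞)⁻¹ < edist x y} ≤ (j + 1 : ℝ≥0∞)⁻¹ :=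
    hcov _ _ (ENNReal.inv_pos.2 (by finiteness)) (ENNReal.inv_pos.2 (by finiteness))
  have hsmall (r : ℝ≥0∞) (hr : 0 < r) : ∃ k : ℕ, (k + 1 : ℝ≥0∞)⁻¹ < r := by
    obtain ⟨k, hk⟩ := ENNReal.exists_inv_nat_lt hr.ne'
    exact ⟨k, lt_of_le_of_lt (ENNReal.inv_le_inv.2 le_self_add) hk⟩
  choose F hF using hcov'
  let D : Set E := ⋃ k, ⋃ j, (F k j : Set E)
  have hDc : D.Countable :=
    Set.countable_iUnion fun k => Set.countable_iUnion fun j => (F k j).countable_toSet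
  have hDae : ∀ᵐ y ∂μ, y ∈ closure D := by
    have h0 (k : ℕ) : μ {y | ∀ x ∈ D, (k + 1 : ℝ≥0∞)⁻¹ < edist x y} = 0 := by
      refine le_antisymm (le_of_forall_gt fun δ hδ => ?_) bot_le
      obtain ⟨j, hj⟩ := hsmall δ hδ
      refine lt_of_le_of_lt ((measure_mono fun y hy x hx => ?_).trans (hF k j)) hj
      exact hy x (Set.mem_iUnion₂.2 ⟨k, j, hx⟩)
    have h1 : ∀ᵐ y ∂μ, ∀ k : ℕ, ¬ ∀ x ∈ D, (k + 1 : ℝ≥0∞)⁻¹ < edist x y :=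
      ae_all_iff.2 fun k => measure_eq_zero_iff_ae_notMem.1 (h0 k)
    filter_upwards [h1] with y hy
    refine Metric.mem_closure_iff_infEDist_zero.2
      (le_antisymm (le_of_forall_gt fun δ hδ => ?_) bot_le)
    obtain ⟨k, hk⟩ := hsmall δ hδ
    have := hy k
    push Not at this
    obtain ⟨x, hx, hxy⟩ := this
    exact ((Metric.infEDist_le_edist_of_mem hx).trans (edist_comm y x ▸ hxy)).trans_lt hk
  let S : Set E := {x | ∀ r : ℝ≥0∞, 0 < r → 0 < μ {y | edist x y < r}}
  have hSD : S ⊆ closure D := by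
    intro x hx
    refine Metric.mem_closure_iff_infEDist_zero.2
      (le_antisymm (le_of_forall_gt fun δ hδ => ?_) bot_le)
    have hne : μ (closure D ∩ {y | edist x y < δ}) ≠ 0 := by
      rw [Measure.measure_inter_eq_of_ae hDae]
      exact (hx δ hδ).ne'
    obtain ⟨y, hyD, hy⟩ := nonempty_of_measure_ne_zero hne
    refine lt_of_le_of_lt ?_ hy
    have := Metric.infEDist_le_edist_add_infEDist (s := D) (x := x) (y := y)
    rwa [Metric.mem_closure_iff_infEDist_zero.1 hyD, add_zero] at this
  have hSsep : TopologicalSpace.IsSeparable S :=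
    (hDc.isSeparable.closure).mono hSD
  have hScl : IsClosed S := by
    refine isClosed_of_closure_subset fun x hx r hr => ?_
    obtain ⟨y, hy, hxy⟩ := EMetric.mem_closure_iff.1 hx (r / 2) (ENNReal.half_pos hr.ne')
    refine (hy (r / 2) (ENNReal.half_pos hr.ne')).trans_le (measure_mono fun z hz => ?_)
    calc edist x z ≤ edist x y + edist y z := edist_triangle _ _ _
      _ < r / 2 + r / 2 := ENNReal.add_lt_add hxy hz
      _ = r := ENNReal.add_halves r
  have hSm : MeasurableSet S := measurableSet_of_isClosed_of_isSeparable hdist hScl hSsep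
  have hSae : ∀ᵐ y ∂μ, y ∈ S := by
    have hnull : ∀ᵐ y ∂μ, ∀ x ∈ D, ∀ k : ℕ, μ {z | edist x z < (k + 1 : ℝ≥0∞)⁻¹} = 0 →
        ¬ edist x y < (k + 1 : ℝ≥0∞)⁻¹ := by
      refine (ae_ball_iff hDc).2 fun x _ => ae_all_iff.2 fun k => ?_
      by_cases h0 : μ {z | edist x z < (k + 1 : ℝ≥0∞)⁻¹} = 0
      · filter_upwards [measure_eq_zero_iff_ae_notMem.1 h0] with y hy _ using hy
      · exact ae_of_all _ fun y h => absurd h h0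
    filter_upwards [hDae, hnull] with y hyD hy r hr
    obtain ⟨k, hk⟩ := hsmall (r / 2) (ENNReal.half_pos hr.ne')
    obtain ⟨x, hx, hxy⟩ := EMetric.mem_closure_iff.1 hyD (k + 1 : ℝ≥0∞)⁻¹
      (ENNReal.inv_pos.2 (by finiteness))
    refine lt_of_lt_of_le (pos_iff_ne_zero.2 fun h0 => hy x hx k h0 (edist_comm y x ▸ hxy))
      (measure_mono fun z hz => ?_)
    calc edist y z ≤ edist y x + edist x z := edist_triangle _ _ _
      _ < r / 2 + r / 2 := ENNReal.add_lt_add (hxy.trans hk) (lt_trans hz hk)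
      _ = r := ENNReal.add_halves r
  have ho' : ∀ᵐ y ∂μ, y ∈ {y | edist o y < ⊤} := ho
  have hSo (x : E) (hx : x ∈ S) : edist o x ≠ ⊤ := by
    have hne : μ ({y | edist o y < ⊤} ∩ {y | edist x y < 1}) ≠ 0 := by
      rw [Measure.measure_inter_eq_of_ae ho']
      exact (hx 1 one_pos).ne'
    obtain ⟨y, hyo, hy⟩ := nonempty_of_measure_ne_zero hne
    refine ne_top_of_le_ne_top ?_ (edist_triangle o y x)
    rw [edist_comm y x]
    exact ENNReal.add_ne_top.2 ⟨hyo.ne, (lt_top_of_lt hy).ne⟩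
  have hfin (x y : S) : edist x y ≠ ⊤ := by
    refine ne_top_of_le_ne_top ?_ (edist_triangle (x : E) o y)
    exact ENNReal.add_ne_top.2 ⟨edist_comm o (x : E) ▸ hSo x x.2, hSo y y.2⟩
  let : MetricSpace S := EMetricSpace.toMetricSpace hfin
  have hScomplete : CompleteSpace S := hScl.completeSpace_coe
  have hSseparable : TopologicalSpace.SeparableSpace S := hSsep.separableSpace
  have hSborel : BorelSpace S := by
    refine ⟨le_antisymm ?_ ?_⟩
    · refine (MeasurableSpace.comap_mono hborel).trans ?_
      rw [borel_comap]
    · rw [borel_eq_generateFrom_isClosed]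
      refine MeasurableSpace.generateFrom_le fun C hC => ?_
      refine ⟨Subtype.val '' C, ?_, Set.preimage_image_eq _ Subtype.val_injective⟩
      refine measurableSet_of_isClosed_of_isSeparable hdist
        (hScl.isClosedEmbedding_subtypeVal.isClosedMap _ hC) (hSsep.mono ?_)
      rintro _ ⟨x, -, rfl⟩
      exact x.2
  have hprob : IsProbabilityMeasure (μ.comap ((↑) : S → E)) := by
    refine ⟨?_⟩
    rw [comap_subtype_coe_apply hSm, Set.image_univ, Subtype.range_coe]
    exact (prob_compl_eq_zero_iff hSm).1 hSae
  have hopen : (μ.comap ((↑) : S → E)).IsOpenPosMeasure := by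
    refine ⟨fun U hU hne => ?_⟩
    obtain ⟨x, hx⟩ := hne
    obtain ⟨r, hr, hrU⟩ := EMetric.isOpen_iff.1 hU x hx
    rw [comap_subtype_coe_apply hSm]
    refine ne_of_gt ((x.2 r hr).trans_le ?_)
    rw [← Measure.measure_inter_eq_of_ae hSae]
    refine measure_mono ?_
    rintro y ⟨hyS, hy⟩
    refine ⟨⟨y, hyS⟩, hrU ?_, rfl⟩
    rw [Metric.mem_eball, edist_comm]
    exact hy
  refine ⟨{ carrier := S, measure := μ.comap ((↑) : S → E) }, Subtype.val, fun _ _ => rfl,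
    measurable_subtype_coe, ?_⟩
  exact (map_comap_subtype_coe hSm μ).trans (Measure.restrict_eq_self_of_ae_mem hSae)

end Realization

/-! ### The inverse limit of a chain -/

namespace MMSpace

/-- The inverse limit of the maps `f n : Y (n + 1) → Y n`, as a set: the compatible sequences. It
carries the supremum of the distances of the coordinates, which may be infinite, and the
`σ`-algebra generated by the coordinates. -/
@[ext]
structure CompatibleSeq (Y : ℕ → MMSpace.{u}) (f : ∀ n, Y (n + 1) → Y n) : Type u where
  val : ∀ n, Y n
  compat : ∀ n, f n (val (n + 1)) = val n

namespace CompatibleSeq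

variable {Y : ℕ → MMSpace.{u}} {f : ∀ n, Y (n + 1) → Y n}

noncomputable instance : EMetricSpace (CompatibleSeq Y f) where
  edist x y := ⨆ n, edist (x.val n) (y.val n)
  edist_self x := by simp
  edist_comm x y := by simp only [edist_comm]
  edist_triangle x y z := iSup_le fun n => (edist_triangle _ (y.val n) _).trans
    (add_le_add (le_iSup (fun n => edist (x.val n) (y.val n)) n)
      (le_iSup (fun n => edist (y.val n) (z.val n)) n))
  eq_of_edist_eq_zero {x y} h := by
    ext n
    exact edist_eq_zero.1 (ENNReal.iSup_eq_zero.1 h n)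

instance : MeasurableSpace (CompatibleSeq Y f) := MeasurableSpace.comap val inferInstance

theorem edist_val_le (x y : CompatibleSeq Y f) (n : ℕ) :
    edist (x.val n) (y.val n) ≤ edist x y :=
  le_iSup (fun n => edist (x.val n) (y.val n)) n

theorem lipschitzWith_val (n : ℕ) : LipschitzWith 1 fun x : CompatibleSeq Y f => x.val n :=
  fun x y => by simpa using edist_val_le x y n

theorem measurable_val : Measurable (val : CompatibleSeq Y f → ∀ n, Y n) :=
  comap_measurable _

theorem measurable_val_apply (n : ℕ) : Measurable fun x : CompatibleSeq Y f => x.val n :=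
  (measurable_pi_apply n).comp measurable_val

theorem measurable_edist (x : CompatibleSeq Y f) : Measurable (edist x) :=
  Measurable.iSup fun n =>
    (continuous_const.edist continuous_id).measurable.comp (measurable_val_apply n)

theorem measurableSpace_le_borel :
    (inferInstance : MeasurableSpace (CompatibleSeq Y f)) ≤ _root_.borel (CompatibleSeq Y f) := by
  refine Measurable.comap_le ?_
  let _ : MeasurableSpace (CompatibleSeq Y f) := _root_.borel _
  have : BorelSpace (CompatibleSeq Y f) := ⟨rfl⟩
  exact measurable_pi_iff.2 fun n => (lipschitzWith_val n).continuous.measurable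

theorem completeSpace (hf : ∀ n, LipschitzWith 1 (f n)) : CompleteSpace (CompatibleSeq Y f) := by
  refine EMetric.complete_of_cauchySeq_tendsto fun x hx => ?_
  have hx' (n : ℕ) : ∃ y, Filter.Tendsto (fun k => (x k).val n) Filter.atTop (nhds y) :=
    cauchySeq_tendsto_of_complete ((lipschitzWith_val n).uniformContinuous.comp_cauchySeq hx)
  choose y hy using hx'
  refine ⟨⟨y, fun n => ?_⟩, ?_⟩
  · refine tendsto_nhds_unique (((hf n).continuous.tendsto _).comp (hy (n + 1))) ?_
    exact (hy n).congr fun k => ((x k).compat n).symm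
  · refine EMetric.tendsto_atTop.2 fun ε hε => ?_
    obtain ⟨δ, hδ, hδε⟩ := exists_between hε
    obtain ⟨N, hN⟩ := EMetric.cauchySeq_iff.1 hx δ hδ
    refine ⟨N, fun k hk => lt_of_le_of_lt (iSup_le fun n => ?_) hδε⟩
    refine le_of_tendsto (tendsto_const_nhds.edist (hy n)) ?_
    filter_upwards [Filter.eventually_ge_atTop N] with l hl
    exact (edist_val_le _ _ n).trans (hN k hk l hl).le

theorem monotone_edist_val (hf : ∀ n, LipschitzWith 1 (f n)) (x y : CompatibleSeq Y f) :
    Monotone fun n => edist (x.val n) (y.val n) :=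
  monotone_nat_of_le_succ fun n => by
    rw [← x.compat n, ← y.compat n]
    simpa using hf n (x.val (n + 1)) (y.val (n + 1))

theorem eventually_lt_edist_val (hf : ∀ n, LipschitzWith 1 (f n)) {x y : CompatibleSeq Y f}
    {c : ℝ≥0∞} (h : c < edist x y) : ∀ᶠ n in Filter.atTop, c < edist (x.val n) (y.val n) := by
  obtain ⟨m, hm⟩ := lt_iSup_iff.1 h
  filter_upwards [Filter.eventually_ge_atTop m] with n hn
  exact hm.trans_le (monotone_edist_val hf x y hn)

theorem exists_measure (hf : ∀ n, LipschitzWith 1 (f n))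
    (hm : ∀ n, (Y (n + 1)).measure.map (f n) = (Y n).measure) :
    ∃ μ : Measure (CompatibleSeq Y f), IsProbabilityMeasure μ ∧
      ∀ n, μ.map (fun x => x.val n) = (Y n).measure := by
  obtain ⟨ν, hν, hνm, hνc⟩ := exists_measure_pi_of_measurePreserving (fun n => (Y n).measure) f
    fun n => ⟨(hf n).continuous.measurable, hm n⟩
  have hrange : Set.range (val : CompatibleSeq Y f → ∀ n, Y n) =
      {x | ∀ n, f n (x (n + 1)) = x n} := by
    ext x
    exact ⟨by rintro ⟨y, rfl⟩; exact y.compat, fun h => ⟨⟨x, h⟩, rfl⟩⟩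
  have hmeas : MeasurableSet (Set.range (val : CompatibleSeq Y f → ∀ n, Y n)) := by
    rw [hrange, Set.ofPred_forall]
    exact MeasurableSet.iInter fun n => measurableSet_eq_fun
      ((hf n).continuous.measurable.comp (measurable_pi_apply _)) (measurable_pi_apply _)
  have hemb : MeasurableEmbedding (val : CompatibleSeq Y f → ∀ n, Y n) := by
    refine ⟨fun x y h => CompatibleSeq.ext h, measurable_val, ?_⟩
    rintro _ ⟨t, ht, rfl⟩
    rw [Set.image_preimage_eq_inter_range]
    exact ht.inter hmeas
  have hmap : (ν.comap val).map (val : CompatibleSeq Y f → ∀ n, Y n) = ν := by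
    rw [hemb.map_comap]
    refine Measure.restrict_eq_self_of_ae_mem ?_
    rw [hrange]
    exact hνc
  refine ⟨ν.comap val, ⟨?_⟩, fun n => ?_⟩
  · have := congrArg (fun m => m Set.univ) hmap
    simpa [Measure.map_apply measurable_val] using this
  · rw [← hνm n]
    conv_rhs => rw [← hmap]
    rw [Measure.map_map (measurable_pi_apply n) measurable_val]
    rfl

end CompatibleSeq

end MMSpace

/-! ### Consequences of the uniform bounds -/

theorem measure_compl_le_ofReal {α : Type*} [MeasurableSpace α] {μ : Measure α}
    [IsProbabilityMeasure μ] {A : Set α} (hA : MeasurableSet A) {κ : ℝ}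
    (h : ENNReal.ofReal (1 - κ) ≤ μ A) : μ Aᶜ ≤ ENNReal.ofReal κ := by
  rw [prob_compl_eq_one_sub hA, tsub_le_iff_right]
  refine le_trans ?_ (add_le_add_right h _)
  rw [← ENNReal.ofReal_one]
  exact (ENNReal.ofReal_le_ofReal (by linarith)).trans ENNReal.ofReal_add_le

theorem le_measure_inter_of_add_le {α : Type*} [MeasurableSpace α] {μ : Measure α} {A J : Set α}
    {c : ℝ≥0∞} (hc : c ≠ ⊤) (hA : μ Aᶜ ≤ c) (hJ : c + c ≤ μ J) : c ≤ μ (A ∩ J) := by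
  refine (ENNReal.add_le_add_iff_right hc).1 (hJ.trans ?_)
  refine (measure_mono (t := (A ∩ J) ∪ Aᶜ) fun y hy => ?_).trans
    ((measure_union_le _ _).trans (add_le_add_right hA _))
  by_cases hyA : y ∈ A
  · exact Or.inl ⟨hyA, hy⟩
  · exact Or.inr hyA

namespace MMSpace

namespace CompatibleSeq

variable {Y : ℕ → MMSpace.{u}} {f : ∀ n, Y (n + 1) → Y n}

theorem measure_preimage_val {μ : Measure (CompatibleSeq Y f)}
    (hμ : ∀ n, μ.map (fun x => x.val n) = (Y n).measure) (n : ℕ) {A : Set (Y n)}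
    (hA : MeasurableSet A) : μ {x | x.val n ∈ A} = (Y n).measure A := by
  rw [← hμ n, Measure.map_apply (measurable_val_apply n) hA]
  rfl

theorem measurableSet_forall_lt_edist (G : Finset (CompatibleSeq Y f)) (r : ℝ≥0∞) :
    MeasurableSet {y | ∀ x ∈ G, r < edist x y} := by
  have : {y | ∀ x ∈ G, r < edist x y} = ⋂ x ∈ G, {y | r < edist x y} := by ext; simp
  rw [this]
  exact G.measurableSet_biInter fun x _ => measurableSet_lt measurable_const (measurable_edist x)

/-- Uniform bounds for the covering numbers of the spaces of a chain make its inverse limit totally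
bounded up to small measure. Otherwise one can pick, one after the other, arbitrarily many points
at mutual distance more than `4r` such that infinitely many `n` see all of these points in the part
of `Y n` covered by few balls. For such a large `n` the distances in `Y n` exceed `4r` too, so the
points lie in different balls. -/
theorem exists_finset_cover (hf : ∀ n, LipschitzWith 1 (f n)) (μ : Measure (CompatibleSeq Y f))
    [IsProbabilityMeasure μ] (hμ : ∀ n, μ.map (fun x => x.val n) = (Y n).measure) {r κ : ℝ}
    (hr : 0 < r) (hκ : 0 < κ) (hcov : ⨆ n, (Y n).cov r κ < ⊤) :
    ∃ F : Finset (CompatibleSeq Y f),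
      μ {y | ∀ x ∈ F, ENNReal.ofReal (4 * r) < edist x y} ≤ ENNReal.ofReal (2 * κ) := by
  obtain ⟨N, hN⟩ := ENat.ne_top_iff_exists.1 hcov.ne
  have hT (n : ℕ) : ∃ T : Set (Y n), ENNReal.ofReal (1 - κ) ≤
      (Y n).measure (Metric.cthickening r T) ∧ T.encard < N + 1 := by
    have : (Y n).cov r κ < N + 1 :=
      ((le_iSup (fun n => (Y n).cov r κ) n).trans hN.ge).trans_lt
        (by exact_mod_cast Nat.lt_succ_self N)
    simpa only [cov, iInf_lt_iff, exists_prop] using this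
  choose T hTm hTc using hT
  let A (n : ℕ) : Set (CompatibleSeq Y f) := {x | x.val n ∈ Metric.cthickening r (T n)}
  have hA (n : ℕ) : MeasurableSet (A n) :=
    measurable_val_apply n Metric.isClosed_cthickening.measurableSet
  have hAc (n : ℕ) : μ (A n)ᶜ ≤ ENNReal.ofReal κ :=
    measure_compl_le_ofReal (hA n)
      ((hTm n).trans_eq (measure_preimage_val hμ n Metric.isClosed_cthickening.measurableSet).symm)
  by_contra! hF
  let V (G : Finset (CompatibleSeq Y f)) : Set (CompatibleSeq Y f) :=
    {y | ∀ x ∈ G, ENNReal.ofReal (4 * r) < edist x y}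
  have hAV (G : Finset (CompatibleSeq Y f)) (n : ℕ) : ENNReal.ofReal κ ≤ μ (A n ∩ V G) := by
    refine le_measure_inter_of_add_le ENNReal.ofReal_ne_top (hAc n) ?_
    rw [← ENNReal.ofReal_add hκ.le hκ.le, ← two_mul]
    exact (hF G).le
  have hsep (k : ℕ) : ∃ G : Finset (CompatibleSeq Y f), G.card = k ∧
      (∀ x ∈ G, ∀ y ∈ G, x ≠ y → ENNReal.ofReal (4 * r) < edist x y) ∧
      ∃ᶠ n in Filter.atTop, ∀ x ∈ G, x ∈ A n := by
    classical
    induction k with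
    | zero => exact ⟨∅, by simp, by simp, Filter.Frequently.of_forall (by simp)⟩
    | succ k ih =>
      obtain ⟨G, hG, hGsep, hGA⟩ := ih
      obtain ⟨x, hx⟩ := exists_frequently_mem_of_frequently_le_measure
        (fun n => (hA n).inter (measurableSet_forall_lt_edist G _))
        (ENNReal.ofReal_pos.2 hκ).ne' hGA fun n _ => hAV G n
      have hxV : x ∈ V G := let ⟨n, hn⟩ := hx.exists; hn.2.2
      have hxG : x ∉ G := fun h => by simpa using hxV x h
      refine ⟨insert x G, by rw [Finset.card_insert_of_notMem hxG, hG], ?_, ?_⟩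
      · intro a ha b hb hab
        rcases Finset.mem_insert.1 ha with ha | ha <;> rcases Finset.mem_insert.1 hb with hb | hb
        · exact absurd (ha.trans hb.symm) hab
        · rw [ha, edist_comm]
          exact hxV b hb
        · rw [hb]
          exact hxV a ha
        · exact hGsep a ha b hb hab
      · refine hx.mono fun n hn a ha => ?_
        rcases Finset.mem_insert.1 ha with rfl | ha
        · exact hn.2.1
        · exact hn.1 a ha
  obtain ⟨G, hG, hGsep, hGA⟩ := hsep (N + 1)
  have hev : ∀ᶠ n in Filter.atTop, ∀ x ∈ G, ∀ y ∈ G, x ≠ y →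
      ENNReal.ofReal (4 * r) < edist (x.val n) (y.val n) := by
    refine (Filter.eventually_all_finset G).2 fun x hx =>
      (Filter.eventually_all_finset G).2 fun y hy => ?_
    by_cases hxy : x = y
    · exact Filter.Eventually.of_forall fun n h => absurd hxy h
    · filter_upwards [eventually_lt_edist_val hf (hGsep x hx y hy hxy)] with n hn _ using hn
  obtain ⟨n, hnA, hn⟩ := (hGA.and_eventually hev).exists
  -- The infimum defining the closed `r`-neighbourhood need not be attained, whence `2 * r`.
  have hnear (x : CompatibleSeq Y f) (hx : x ∈ G) :
      ∃ t ∈ T n, edist (x.val n) t < ENNReal.ofReal (2 * r) := by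
    refine Metric.infEDist_lt_iff.1 ((Metric.mem_cthickening_iff.1 (hnA x hx)).trans_lt ?_)
    exact (ENNReal.ofReal_lt_ofReal_iff (by linarith)).2 (by linarith)
  have : Nonempty (Y n) := nonempty_of_isProbabilityMeasure (Y n).measure
  choose! g hgT hg using hnear
  have hinj : Set.InjOn g (G : Set (CompatibleSeq Y f)) := by
    intro x hx y hy hxy
    by_contra hne
    refine lt_irrefl _ ((hn x hx y hy hne).trans_le ?_)
    calc edist (x.val n) (y.val n) ≤ edist (x.val n) (g x) + edist (g x) (y.val n) :=
          edist_triangle _ _ _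
      _ ≤ ENNReal.ofReal (2 * r) + ENNReal.ofReal (2 * r) := by
          refine add_le_add (hg x hx).le ?_
          rw [hxy, edist_comm]
          exact (hg y hy).le
      _ = ENNReal.ofReal (4 * r) := by
          rw [← ENNReal.ofReal_add (by linarith) (by linarith)]
          ring_nf
  have hcard := Set.encard_le_encard_of_injOn (t := T n) (fun x hx => hgT x hx) hinj
  rw [Set.encard_coe_eq_coe_finsetCard, hG] at hcard
  exact lt_irrefl _ ((hcard.trans_lt (hTc n)).trans_le (by simp))

/-- Uniform bounds for the observable diameters of the spaces of a chain prevent mass at infinity: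
if the ball of infinite radius at `o` has positive measure, then it has full measure. Otherwise the
distances to `o n` in `Y n` are, for each `n`, within bounded distance of each other on a set that
meets both the points at finite and the points at infinite distance from `o`. Some pair of such
points is seen by infinitely many `n`, while one of its distances to `o n` stays bounded and the
other tends to infinity. -/
theorem ae_edist_lt_top (hf : ∀ n, LipschitzWith 1 (f n)) (μ : Measure (CompatibleSeq Y f))
    [IsProbabilityMeasure μ] (hμ : ∀ n, μ.map (fun x => x.val n) = (Y n).measure)
    (hobs : ∀ κ : ℝ, 0 < κ → κ < 1 → ⨆ n, (Y n).obsDiam κ < ⊤) {o : CompatibleSeq Y f}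
    (ho : μ {x | edist o x < ⊤} ≠ 0) : ∀ᵐ x ∂μ, edist o x < ⊤ := by
  let I : Set (CompatibleSeq Y f) := {x | edist o x < ⊤}
  have hI : MeasurableSet I := measurableSet_lt (measurable_edist o) measurable_const
  by_contra hnot
  have hIc : μ Iᶜ ≠ 0 := hnot
  -- `2κ` is at most the mass of either part.
  obtain ⟨κ, hκ, hκ1, hκI, hκIc⟩ : ∃ κ : ℝ, 0 < κ ∧ κ < 1 ∧
      ENNReal.ofReal κ + ENNReal.ofReal κ ≤ μ I ∧ ENNReal.ofReal κ + ENNReal.ofReal κ ≤ μ Iᶜ := by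
    have hm : 0 < min (μ.real I) (μ.real Iᶜ) :=
      lt_min (ENNReal.toReal_pos ho (measure_ne_top _ _))
        (ENNReal.toReal_pos hIc (measure_ne_top _ _))
    have h1 : min (μ.real I) (μ.real Iᶜ) ≤ 1 := (min_le_left _ _).trans measureReal_le_one
    refine ⟨min (μ.real I) (μ.real Iᶜ) / 2, by linarith, by linarith, ?_, ?_⟩ <;>
      rw [← ENNReal.ofReal_add (by linarith) (by linarith), add_halves]
    · exact ENNReal.ofReal_le_of_le_toReal (min_le_left _ _)
    · exact ENNReal.ofReal_le_of_le_toReal (min_le_right _ _)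
  set D := ⨆ n, (Y n).obsDiam κ
  have hDtop : D < ⊤ := hobs κ hκ hκ1
  have hB (n : ℕ) : ∃ B : Set ℝ, MeasurableSet B ∧
      ENNReal.ofReal (1 - κ) ≤ (Y n).measure.map (dist (o.val n)) B ∧ Metric.ediam B < D + 1 := by
    have hle : partialDiam ((Y n).measure.map (dist (o.val n))) (1 - κ) < D + 1 := by
      refine lt_of_le_of_lt ?_ (ENNReal.lt_add_right hDtop.ne one_ne_zero)
      refine le_trans ?_ (le_iSup (fun n => (Y n).obsDiam κ) n)
      exact le_iSup₂ (f := fun (g : Y n → ℝ) (_ : LipschitzWith 1 g) =>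
        partialDiam ((Y n).measure.map g) (1 - κ)) _ (LipschitzWith.dist_right (o.val n))
    simpa only [partialDiam, iInf_lt_iff, exists_prop] using hle
  choose B hBm hBκ hBd using hB
  have hdm (n : ℕ) : Measurable (dist (o.val n)) :=
    (LipschitzWith.dist_right _).continuous.measurable
  let A (n : ℕ) : Set (CompatibleSeq Y f) := {x | x.val n ∈ dist (o.val n) ⁻¹' B n}
  have hA (n : ℕ) : MeasurableSet (A n) := measurable_val_apply n (hdm n (hBm n))
  have hAc (n : ℕ) : μ (A n)ᶜ ≤ ENNReal.ofReal κ := by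
    refine measure_compl_le_ofReal (hA n) ((hBκ n).trans_eq ?_)
    rw [Measure.map_apply (hdm n) (hBm n)]
    exact (measure_preimage_val hμ n (hdm n (hBm n))).symm
  have hinter (J : Set (CompatibleSeq Y f)) (hJ : ENNReal.ofReal κ + ENNReal.ofReal κ ≤ μ J)
      (n : ℕ) : ENNReal.ofReal κ ≤ μ (A n ∩ J) :=
    le_measure_inter_of_add_le ENNReal.ofReal_ne_top (hAc n) hJ
  have hκ0 := (ENNReal.ofReal_pos.2 hκ).ne'
  obtain ⟨x, hx⟩ := exists_frequently_mem_of_frequently_le_measure (p := fun _ => True)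
    (fun n => (hA n).inter hI) hκ0 (Filter.Frequently.of_forall fun _ => trivial)
    fun n _ => hinter I hκI n
  obtain ⟨y, hy⟩ := exists_frequently_mem_of_frequently_le_measure
    (fun n => (hA n).inter hI.compl) hκ0 hx fun n _ => hinter Iᶜ hκIc n
  have hxI : edist o x < ⊤ := let ⟨n, hn⟩ := hx.exists; hn.2.2
  have hyI : edist o y = ⊤ := by
    obtain ⟨n, hn⟩ := hy.exists
    simpa [I] using hn.2.2
  have hlt : edist o x + (D + 1) < edist o y := by
    rw [hyI]
    exact ENNReal.add_lt_top.2 ⟨hxI, ENNReal.add_lt_top.2 ⟨hDtop, ENNReal.one_lt_top⟩⟩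
  obtain ⟨n, hn, hlt'⟩ := (hy.and_eventually (eventually_lt_edist_val hf hlt)).exists
  refine lt_irrefl _ (hlt'.trans_le ?_)
  have hdist : edist (dist (o.val n) (y.val n)) (dist (o.val n) (x.val n)) ≤ D + 1 :=
    (Metric.edist_le_ediam_of_mem (s := B n) hn.2.1 hn.1.2.1).trans (hBd n).le
  rw [edist_dist, Real.dist_eq] at hdist
  calc edist (o.val n) (y.val n)
      ≤ ENNReal.ofReal (dist (o.val n) (x.val n) +
          |dist (o.val n) (y.val n) - dist (o.val n) (x.val n)|) := by
        rw [edist_dist]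
        exact ENNReal.ofReal_le_ofReal (sub_le_iff_le_add'.1 (le_abs_self _))
    _ ≤ edist o x + (D + 1) := by
        refine ENNReal.ofReal_add_le.trans (add_le_add ?_ hdist)
        rw [← edist_dist]
        exact edist_val_le o x n

end CompatibleSeq

/-! ### Limits of increasing chains -/

/-- A measure-preserving map that almost preserves distances on a large set bounds the box distance:
take the coupling carried by its graph, and the part of the graph over that set. -/
theorem boxDist_le_of_map_eq {X Y : MMSpace.{u}} {p : X → Y} (hp : Measurable p)
    (hm : X.measure.map p = Y.measure) {A : Set X} (hA : MeasurableSet A) {ε : ℝ≥0∞}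
    (hAε : X.measure Aᶜ ≤ ε)
    (hd : ∀ x ∈ A, ∀ y ∈ A, ENNReal.ofReal |dist x y - dist (p x) (p y)| ≤ ε) :
    boxDist X Y ≤ ε := by
  have hg : Measurable fun x => (x, p x) := measurable_id.prodMk hp
  have hS : MeasurableSet {q : X × Y | q.1 ∈ A ∧ p q.1 = q.2} :=
    (measurable_fst hA).inter (measurableSet_eq_fun (hp.comp measurable_fst) measurable_snd)
  have hπ : IsCoupling X Y (X.measure.map fun x => (x, p x)) := by
    constructor
    · rw [Measure.map_map measurable_fst hg]
      exact Measure.map_id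
    · rw [Measure.map_map measurable_snd hg]
      exact hm
  refine (iInf₂_le _ hπ).trans ((iInf₂_le _ hS).trans (max_le ?_ ?_))
  · refine iSup₂_le fun q hq => iSup₂_le fun q' hq' => ?_
    rw [← hq.2, ← hq'.2]
    exact hd _ hq.1 _ hq'.1
  · rw [Measure.map_apply hg hS]
    have : (fun x => (x, p x)) ⁻¹' {q : X × Y | q.1 ∈ A ∧ p q.1 = q.2} = A := by
      ext x
      simp
    rwa [this, ← prob_compl_eq_one_sub hA]

/-- A chain in the Lipschitz order with uniformly bounded covering numbers and observable diameters
has an upper bound that is a limit of the chain in the box topology: its inverse limit. -/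
theorem exists_dominates_forall_boxDist_le {Y : ℕ → MMSpace.{u}}
    (hY : ∀ n, (Y (n + 1)).Dominates (Y n))
    (hcov : ∀ r κ : ℝ, 0 < r → 0 < κ → κ < 1 → ⨆ n, (Y n).cov r κ < ⊤)
    (hobs : ∀ κ : ℝ, 0 < κ → κ < 1 → ⨆ n, (Y n).obsDiam κ < ⊤) :
    ∃ X : MMSpace.{u}, (∀ n, X.Dominates (Y n)) ∧
      ∀ ε : ℝ≥0∞, 0 < ε → ∃ n, boxDist X (Y n) ≤ ε := by
  choose f hf hfm using hY
  obtain ⟨μ, hμ, hμm⟩ := CompatibleSeq.exists_measure hf hfm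
  have hcomplete := CompatibleSeq.completeSpace hf
  have htot (ε κ : ℝ≥0∞) (hε : 0 < ε) (hκ : 0 < κ) :
      ∃ F : Finset (CompatibleSeq Y f), μ {y | ∀ x ∈ F, ε < edist x y} ≤ κ := by
    obtain ⟨ε', hε', hεε'⟩ := ENNReal.lt_iff_exists_real_btwn.1 hε
    obtain ⟨κ', hκ', hκκ'⟩ := ENNReal.lt_iff_exists_real_btwn.1 hκ
    have hε0 : 0 < ε' := ENNReal.ofReal_pos.1 hεε'.1
    have hκ0 : 0 < κ' := ENNReal.ofReal_pos.1 hκκ'.1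
    have hκm : 0 < min (κ' / 2) (1 / 2) := lt_min (by linarith) (by norm_num)
    obtain ⟨F, hF⟩ := CompatibleSeq.exists_finset_cover hf μ hμm (r := ε' / 4)
      (by linarith) hκm (hcov _ _ (by linarith) hκm ((min_le_right _ _).trans_lt (by norm_num)))
    refine ⟨F, (measure_mono fun y hy x hx => ?_).trans (hF.trans ?_)⟩
    · refine lt_of_eq_of_lt ?_ (hεε'.2.trans (hy x hx))
      congr 1
      ring
    · refine (ENNReal.ofReal_le_ofReal ?_).trans hκκ'.2.le
      linarith [min_le_left (κ' / 2) (1 / 2)]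
  obtain ⟨o, ho⟩ : ∃ o : CompatibleSeq Y f, μ {x | edist o x < ⊤} ≠ 0 := by
    obtain ⟨F, hF⟩ := htot 1 (1 / 2) one_pos (by simp)
    by_contra! h
    have hnull : ∀ᵐ y ∂μ, ∀ x ∈ F, 1 < edist x y := by
      refine (ae_ball_iff F.countable_toSet).2 fun x _ => ?_
      filter_upwards [measure_eq_zero_iff_ae_notMem.1 (h x)] with y hy
      have : edist x y = ⊤ := by simpa using hy
      simp [this]
    have h1 : μ {y | ∀ x ∈ F, 1 < edist x y} = 1 :=
      (measure_congr (Filter.eventuallyEq_univ.2 hnull)).trans measure_univ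
    rw [h1, one_div] at hF
    exact absurd hF (not_le.2 (ENNReal.inv_lt_one.2 ENNReal.one_lt_two))
  obtain ⟨X, ι, hι, hιm, hιμ⟩ := exists_mmSpace_isometry μ CompatibleSeq.measurable_edist
    CompatibleSeq.measurableSpace_le_borel
    (CompatibleSeq.ae_edist_lt_top hf μ hμm hobs ho) htot
  have hp (n : ℕ) : LipschitzWith 1 fun x => (ι x).val n := by
    simpa [Function.comp_def] using (CompatibleSeq.lipschitzWith_val n).comp hι.lipschitz
  have hpm (n : ℕ) : X.measure.map (fun x => (ι x).val n) = (Y n).measure := by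
    rw [← hμm n, ← hιμ, Measure.map_map (CompatibleSeq.measurable_val_apply n) hιm]
    rfl
  refine ⟨X, fun n => ⟨_, hp n, hpm n⟩, fun ε hε => ?_⟩
  obtain ⟨δ, hδ, hδε⟩ := ENNReal.lt_iff_exists_real_btwn.1 hε
  have hδ0 : 0 < δ := ENNReal.ofReal_pos.1 hδε.1
  obtain ⟨F, hF⟩ := htot (ENNReal.ofReal (δ / 5)) ε (ENNReal.ofReal_pos.2 (by linarith)) hε
  -- Up to `δ / 5`, the finitely many distances inside `F` are attained at a finite level, and
  -- every other distance on the part near `F` differs from one of these by at most `2δ / 5`.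
  have hev : ∀ᶠ n in Filter.atTop, ∀ a ∈ F, ∀ b ∈ F, edist a b < ⊤ →
      edist a b ≤ edist (a.val n) (b.val n) + ENNReal.ofReal (δ / 5) := by
    refine (Filter.eventually_all_finset F).2 fun a _ =>
      (Filter.eventually_all_finset F).2 fun b _ => ?_
    by_cases hab : edist a b = 0
    · exact Filter.Eventually.of_forall fun n _ => by simp [hab]
    by_cases htop : edist a b = ⊤
    · exact Filter.Eventually.of_forall fun n h => absurd htop h.ne
    have hlt : edist a b - ENNReal.ofReal (δ / 5) < edist a b :=
      ENNReal.sub_lt_self htop hab (ENNReal.ofReal_pos.2 (by linarith)).ne'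
    filter_upwards [CompatibleSeq.eventually_lt_edist_val hf hlt] with n hn _
    exact tsub_le_iff_right.1 hn.le
  obtain ⟨n, hn⟩ := hev.exists
  have hbad := CompatibleSeq.measurableSet_forall_lt_edist F (ENNReal.ofReal (δ / 5))
  refine ⟨n, boxDist_le_of_map_eq (hp n).continuous.measurable (hpm n)
    (A := {x | ∀ a ∈ F, ENNReal.ofReal (δ / 5) < edist a (ι x)}ᶜ) (hιm hbad).compl ?_ ?_⟩
  · rw [compl_compl]
    refine le_trans (le_of_eq ?_) hF
    rw [← hιμ, Measure.map_apply hιm hbad]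
    rfl
  · intro x hx y hy
    simp only [Set.mem_compl_iff, Set.mem_ofPred_eq, not_forall, not_lt, exists_prop] at hx hy
    obtain ⟨a, ha, hax⟩ := hx
    obtain ⟨b, hb, hby⟩ := hy
    set e := ENNReal.ofReal (δ / 5) with he
    have hetop : e < ⊤ := ENNReal.ofReal_lt_top
    have hxy : edist (ι x) (ι y) = edist x y := hι x y
    have hab : edist a b < ⊤ := by
      refine (edist_triangle4 a (ι x) (ι y) b).trans_lt ?_
      rw [hxy, edist_comm (ι y) b]
      exact ENNReal.add_lt_top.2
        ⟨ENNReal.add_lt_top.2 ⟨hax.trans_lt hetop, edist_lt_top x y⟩, hby.trans_lt hetop⟩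
    have hle : edist x y ≤ edist ((ι x).val n) ((ι y).val n) + ENNReal.ofReal δ := by
      calc edist x y ≤ edist (ι x) a + edist a b + edist b (ι y) :=
            hxy ▸ edist_triangle4 _ _ _ _
        _ ≤ e + (edist (a.val n) (b.val n) + e) + e := by
            refine add_le_add (add_le_add ?_ (hn a ha b hb hab)) hby
            rwa [edist_comm]
        _ ≤ e + ((e + edist ((ι x).val n) ((ι y).val n) + e) + e) + e := by
            gcongr
            refine (edist_triangle4 _ ((ι x).val n) ((ι y).val n) _).trans ?_
            gcongr
            · exact (CompatibleSeq.edist_val_le _ _ n).trans hax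
            · rw [edist_comm]
              exact (CompatibleSeq.edist_val_le _ _ n).trans hby
        _ = edist ((ι x).val n) ((ι y).val n) + 5 * e := by ring
        _ = edist ((ι x).val n) ((ι y).val n) + ENNReal.ofReal δ := by
            rw [he, ← ENNReal.ofReal_ofNat 5, ← ENNReal.ofReal_mul (by norm_num)]
            congr 2
            ring
    refine (ENNReal.ofReal_le_ofReal ?_).trans hδε.2.le
    have hpd : dist ((ι x).val n) ((ι y).val n) ≤ dist x y := by
      simpa using (hp n).dist_le_mul x y
    rw [abs_of_nonneg (sub_nonneg.2 hpd), sub_le_iff_le_add']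
    rw [edist_dist, edist_dist, ← ENNReal.ofReal_add dist_nonneg hδ0.le] at hle
    exact (ENNReal.ofReal_le_ofReal_iff (add_nonneg dist_nonneg hδ0.le)).1 hle

end MMSpace

namespace MMClass

/-! ### Pyramids -/

theorem mem_of_isPyramid_of_forall_boxDist_le {P : Set MMClass.{u}} (hP : IsPyramid P)
    {X : MMSpace.{u}}
    (h : ∀ ε : ℝ≥0∞, 0 < ε → ∃ Y : MMSpace.{u}, mk Y ∈ P ∧ MMSpace.boxDist X Y ≤ ε) :
    mk X ∈ P := by
  by_contra hX
  obtain ⟨ε, hε, hball⟩ := hP.closed.isOpen_compl X hX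
  obtain ⟨δ, hδ, hδε⟩ := exists_between hε
  obtain ⟨Y, hY, hd⟩ := h δ hδ
  exact hball Y (hd.trans_lt hδε) hY

theorem mk_mem_associatedPyramid {X Y : MMSpace.{u}} :
    mk Y ∈ associatedPyramid X ↔ X.Dominates Y := by
  refine ⟨?_, fun h => ⟨Y, rfl, h⟩⟩
  rintro ⟨Z, hZ, h⟩
  exact h.trans (MMSpace.Iso.dominates (Quotient.exact hZ))

/-- A pyramid with finite covering numbers and finite observable diameters contains an element of
maximal spread: take an increasing chain whose spreads approach the supremum, and its limit. -/
theorem exists_forall_spread_le_of_isPyramid {P : Set MMClass.{u}} (hP : IsPyramid P)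
    (hfin : FiniteObsDiam P) (hcov : ∀ r κ : ℝ, 0 < r → 0 < κ → κ < 1 → cov P r κ < ⊤) :
    ∃ X : MMSpace.{u}, mk X ∈ P ∧ ∀ Y : MMSpace.{u}, mk Y ∈ P → Y.spread ≤ X.spread := by
  have hne : (MMSpace.spread '' {X : MMSpace.{u} | mk X ∈ P}).Nonempty := by
    obtain ⟨x, hx⟩ := hP.nonempty
    obtain ⟨X, rfl⟩ := Quotient.exists_rep x
    exact ⟨_, X, hx, rfl⟩
  obtain ⟨s, -, hs, hsP⟩ := exists_seq_tendsto_sSup hne (OrderTop.bddAbove _)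
  choose W hW hWs using hsP
  choose Z hZ hZ₁ hZ₂ using hP.directed
  let Y (n : ℕ) : {X : MMSpace.{u} // mk X ∈ P} :=
    Nat.rec ⟨W 0, hW 0⟩ (fun n X => ⟨Z X.1 (W (n + 1)) X.2 (hW (n + 1)), hZ _ _ _ _⟩) n
  have hYW (n : ℕ) : W n = (Y n).1 ∨ (Y n).1.Dominates (W n) := by
    cases n with
    | zero => exact Or.inl rfl
    | succ n => exact Or.inr (hZ₂ _ _ _ _)
  obtain ⟨X, hXY, hXd⟩ := MMSpace.exists_dominates_forall_boxDist_le (Y := fun n => (Y n).1)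
    (fun n => hZ₁ _ _ _ _)
    (fun r κ hr hκ hκ1 => lt_of_le_of_lt (iSup_le fun n =>
      le_iSup₂ (f := fun (X : MMSpace.{u}) (_ : mk X ∈ P) => X.cov r κ) (Y n).1 (Y n).2)
      (hcov r κ hr hκ hκ1))
    (fun κ hκ hκ1 => lt_of_le_of_lt (iSup_le fun n =>
      le_iSup₂ (f := fun (X : MMSpace.{u}) (_ : mk X ∈ P) => X.obsDiam κ) (Y n).1 (Y n).2)
      (hfin κ hκ hκ1))
  refine ⟨X, mem_of_isPyramid_of_forall_boxDist_le hP fun ε hε => ?_, fun V hV => ?_⟩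
  · obtain ⟨n, hn⟩ := hXd ε hε
    exact ⟨_, (Y n).2, hn⟩
  · have hVs : V.spread ≤ sSup (MMSpace.spread '' {X : MMSpace.{u} | mk X ∈ P}) :=
      le_sSup ⟨V, hV, rfl⟩
    refine hVs.trans (le_of_tendsto' hs fun n => ?_)
    rw [← hWs n]
    rcases hYW n with h | h
    · rw [h]
      exact (hXY n).spread_le
    · exact ((hXY n).trans h).spread_le

theorem cov_associatedPyramid_lt_top (X : MMSpace.{u}) {r κ : ℝ} (hr : 0 < r) (hκ : 0 < κ) :
    cov (associatedPyramid X) r κ < ⊤ :=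
  lt_of_le_of_lt (iSup₂_le fun _ hY => (mk_mem_associatedPyramid.1 hY).cov_le r κ)
    (X.cov_lt_top hr hκ)

end MMClass

theorem mainTheorem5 (P : Set MMClass.{u}) (hP : MMClass.IsPyramid P)
    (hfin : MMClass.FiniteObsDiam P) :
    (∀ r κ : ℝ, 0 < r → 0 < κ → κ < 1 → MMClass.cov P r κ < ⊤) ↔
      ∃ X : MMSpace.{u}, P = MMClass.associatedPyramid X := by
  refine ⟨fun hcov => ?_, ?_⟩
  · obtain ⟨X, hX, hmax⟩ := MMClass.exists_forall_spread_le_of_isPyramid hP hfin hcov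
    refine ⟨X, Set.Subset.antisymm (fun y hy => ?_) ?_⟩
    · obtain ⟨Y, rfl⟩ := Quotient.exists_rep y
      obtain ⟨Z, hZ, hZX, hZY⟩ := hP.directed X Y hX hy
      have hiso : MMSpace.Iso Z X := hZX.iso_of_spread_le (hmax Z hZ)
      exact ⟨Y, rfl, hiso.symm.dominates.trans hZY⟩
    · rintro _ ⟨Y, rfl, hXY⟩
      exact hP.downward Y X hX hXY
  · rintro ⟨X, rfl⟩ r κ hr hκ _
    exact MMClass.cov_associatedPyramid_lt_top X hr hκ
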